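/- Let $X$ be a compact Hausdorff, path-connected, locally path-connected topological space admitting a universal cover (that is, a covering space which is simply connected). Let $G$ be a group of homeomorphisms of $X$ acting trivially on the singular cohomology $H^1(X;\mathbb R)$, and let $g\in G$ be distorted in $G$. Here $g$ is called undistorted in $G$ if for every finitely generated subgroup $\Gamma\subseteq G$ containing $g$, with a finite generating set and the associated word norm $|\cdot|$, the translation length $\tau(g)=\lim_{n\to\infty}|g^n|/n$ is positive; and $g$ is distorted if it is not undistorted. Let $\ell_1,\ell_2\subset X$ be oriented simple closed curves preserved by $g$ (with their orientations), whose classes $[\ell_1],[\ell_2]\in H_1(X;\mathbb R)$ are nonzero, and let $\rho_1,\rho_2\in\mathbb R/\mathbb Z$ be the topological rotation numbers of the action of $g$ on $\ell_1$ and $\ell_2$. (If $F:\mathbb R\to\mathbb R$ is a lift of an orientation preserving homeomorphism of $\mathbb R/\mathbb Z$, then the rotation number is $\lim_{n\to\infty}(F^n(t)-t)/n$ modulo $\mathbb Z$.) Then the following statements are true. 1. There exist nonzero integers $k_1,k_2$ such that $k_1\rho_1=k_2\rho_2$ in $\mathbb R/\mathbb Z$. 2. If $[\ell_1]$ and $[\ell_2]$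 are linearly independent in $H_1(X;\mathbb R)$, then $\rho_1$ and $\rho_2$ are both rational, that is, they lie in $\mathbb Q/\mathbb Z$. -/

import Mathlib

open Filter Topology

noncomputable section

namespace Distortion

/-! ### Word norm, translation length, distortion -/

/-- The word norm of `g` with respect to `S`: the least length of a word in the elements of `S` and
their inverses that represents `g`. -/
def wordNorm {G : Type*} [Group G] (S : Set G) (g : G) : ℕ :=
  sInf {k : ℕ | ∃ l : List G, (∀ s ∈ l, s ∈ S ∨ s⁻¹ ∈ S) ∧ l.prod = g ∧ l.length = k}

/-- The translation length `τ(g) = lim |g ^ n| / n`. -/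
def translationLength {G : Type*} [Group G] (S : Set G) (g : G) : ℝ :=
  limUnder atTop (fun n : ℕ => (wordNorm S (g ^ n) : ℝ) / n)

theorem exists_word {G : Type*} [Group G] {S : Set G} {g : G} (hg : g ∈ Subgroup.closure S) :
    ∃ l : List G, (∀ s ∈ l, s ∈ S ∨ s⁻¹ ∈ S) ∧ l.prod = g ∧ l.length = wordNorm S g := by
  rw [← Subgroup.mem_toSubmonoid, Subgroup.closure_toSubmonoid] at hg
  obtain ⟨l, hl, hp⟩ := Submonoid.exists_list_of_mem_closure hg
  exact Nat.sInf_mem (s := {k : ℕ | ∃ l : List G, (∀ s ∈ l, s ∈ S ∨ s⁻¹ ∈ S) ∧ l.prod = g ∧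
    l.length = k}) ⟨l.length, l, hl, hp, rfl⟩

/-- The limit in the definition of the translation length exists. -/
theorem tendsto_translationLength {G : Type*} [Group G] {S : Set G} {g : G}
    (hg : g ∈ Subgroup.closure S) :
    Tendsto (fun n : ℕ => (wordNorm S (g ^ n) : ℝ) / n) atTop (𝓝 (translationLength S g)) := by
  have hs : Subadditive (fun n : ℕ => (wordNorm S (g ^ n) : ℝ)) := by
    intro m n
    obtain ⟨l, hl, hp, hk⟩ := exists_word (pow_mem hg m)
    obtain ⟨l', hl', hp', hk'⟩ := exists_word (pow_mem hg n)
    have : wordNorm S (g ^ (m + n)) ≤ wordNorm S (g ^ m) + wordNorm S (g ^ n) := by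
      refine Nat.sInf_le ⟨l ++ l', ?_, ?_, ?_⟩
      · intro s h
        rcases List.mem_append.1 h with h | h
        exacts [hl s h, hl' s h]
      · rw [List.prod_append, hp, hp', pow_add]
      · rw [List.length_append, hk, hk']
    simpa using (by exact_mod_cast this : (wordNorm S (g ^ (m + n)) : ℝ) ≤
      wordNorm S (g ^ m) + wordNorm S (g ^ n))
  refine tendsto_nhds_limUnder ⟨_, hs.tendsto_lim ⟨0, ?_⟩⟩
  rintro _ ⟨n, rfl⟩
  positivity

/-- `g` is undistorted in `G` if its translation length is positive in every finitely generated
subgroup of `G` containing it (for every finite generating set of that subgroup). -/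
def IsUndistorted {G : Type*} [Group G] (g : G) : Prop :=
  ∀ S : Set G, S.Finite → g ∈ Subgroup.closure S → 0 < translationLength S g

/-- `g` is distorted in `G` if it is not undistorted. -/
def IsDistorted {G : Type*} [Group G] (g : G) : Prop :=
  ¬ IsUndistorted g

/-! ### Singular homology and cohomology in degree one -/

/-- Singular `n`-simplices of `X`. -/
abbrev SingularSimplex (n : ℕ) (X : Type*) [TopologicalSpace X] : Type _ :=
  C(stdSimplex ℝ (Fin (n + 1)), X)

/-- The `i`-th face of a singular simplex (the one opposite to the `i`-th vertex). -/
def SingularSimplex.face {n : ℕ} {X : Type*} [TopologicalSpace X] (i : Fin (n + 2))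
    (σ : SingularSimplex (n + 1) X) : SingularSimplex n X :=
  σ.comp ⟨stdSimplex.map i.succAbove, stdSimplex.continuous_map _⟩

section Coefficients

variable (R : Type*) [CommRing R]

/-- Singular `n`-chains of `X` with coefficients in `R`: the free `R`-module on the singular
`n`-simplices. -/
def SingularChain (n : ℕ) (X : Type*) [TopologicalSpace X] : Type _ :=
  SingularSimplex n X →₀ R

instance (n : ℕ) (X : Type*) [TopologicalSpace X] : AddCommGroup (SingularChain R n X) :=
  inferInstanceAs (AddCommGroup (SingularSimplex n X →₀ R))

instance (n : ℕ) (X : Type*) [TopologicalSpace X] : Module R (SingularChain R n X) :=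
  inferInstanceAs (Module R (SingularSimplex n X →₀ R))

/-- The basis of the module of chains given by the simplices. -/
def simplexBasis (n : ℕ) (X : Type*) [TopologicalSpace X] :
    Module.Basis (SingularSimplex n X) R (SingularChain R n X) :=
  Module.Basis.ofRepr (LinearEquiv.refl R (SingularSimplex n X →₀ R))

/-- Singular `n`-cochains of `X` with coefficients in `R`. -/
abbrev SingularCochain (n : ℕ) (X : Type*) [TopologicalSpace X] : Type _ :=
  SingularSimplex n X → R

/-- The boundary `∂ σ = ∑ i, (-1) ^ i • (i-th face of σ)`. -/
def boundary (n : ℕ) (X : Type*) [TopologicalSpace X] :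
    SingularChain R (n + 1) X →ₗ[R] SingularChain R n X :=
  (simplexBasis R (n + 1) X).constr R fun σ : SingularSimplex (n + 1) X =>
    ∑ i : Fin (n + 2), (-1 : R) ^ (i : ℕ) • simplexBasis R n X (σ.face i)

/-- The coboundary, dual to `boundary`. -/
def coboundary (n : ℕ) (X : Type*) [TopologicalSpace X] :
    SingularCochain R n X →ₗ[R] SingularCochain R (n + 1) X where
  toFun c σ := ∑ i : Fin (n + 2), (-1 : R) ^ (i : ℕ) * c (σ.face i)
  map_add' c d := by
    ext σ
    simp [mul_add, Finset.sum_add_distrib]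
  map_smul' r c := by
    ext σ
    simp only [Pi.smul_apply, smul_eq_mul, RingHom.id_apply, Finset.mul_sum]
    exact Finset.sum_congr rfl fun i _ => by ring

/-- Singular one-cycles. -/
def oneCycles (X : Type*) [TopologicalSpace X] : Submodule R (SingularChain R 1 X) :=
  LinearMap.ker (boundary R 0 X)

/-- The one-cycles that are boundaries. -/
def oneBoundaries (X : Type*) [TopologicalSpace X] : Submodule R (oneCycles R X) :=
  (LinearMap.range (boundary R 1 X)).comap (oneCycles R X).subtype

/-- The first singular homology `H₁(X; R)`: cycles modulo boundaries. -/
def HomologyOne (X : Type*) [TopologicalSpace X] : Type _ := oneCycles R X ⧸ oneBoundaries R X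

instance (X : Type*) [TopologicalSpace X] : AddCommGroup (HomologyOne R X) :=
  inferInstanceAs (AddCommGroup (oneCycles R X ⧸ oneBoundaries R X))

instance (X : Type*) [TopologicalSpace X] : Module R (HomologyOne R X) :=
  inferInstanceAs (Module R (oneCycles R X ⧸ oneBoundaries R X))

/-- The homology class of a one-cycle. -/
def homologyClass (X : Type*) [TopologicalSpace X] : oneCycles R X →ₗ[R] HomologyOne R X :=
  (oneBoundaries R X).mkQ

/-- Singular one-cocycles. -/
def oneCocycles (X : Type*) [TopologicalSpace X] : Submodule R (SingularCochain R 1 X) :=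
  LinearMap.ker (coboundary R 1 X)

/-- The one-cocycles that are coboundaries. -/
def oneCoboundaries (X : Type*) [TopologicalSpace X] : Submodule R (oneCocycles R X) :=
  (LinearMap.range (coboundary R 0 X)).comap (oneCocycles R X).subtype

/-- The first singular cohomology `H¹(X; R)`: cocycles modulo coboundaries. -/
def CohomologyOne (X : Type*) [TopologicalSpace X] : Type _ :=
  oneCocycles R X ⧸ oneCoboundaries R X

instance (X : Type*) [TopologicalSpace X] : AddCommGroup (CohomologyOne R X) :=
  inferInstanceAs (AddCommGroup (oneCocycles R X ⧸ oneCoboundaries R X))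

instance (X : Type*) [TopologicalSpace X] : Module R (CohomologyOne R X) :=
  inferInstanceAs (Module R (oneCocycles R X ⧸ oneCoboundaries R X))

/-- Pull-back of singular cochains by a continuous map. -/
def cochainPullback (n : ℕ) {X Y : Type*} [TopologicalSpace X] [TopologicalSpace Y] (f : C(X, Y)) :
    SingularCochain R n Y →ₗ[R] SingularCochain R n X :=
  LinearMap.funLeft R R fun σ : SingularSimplex n X => f.comp σ

theorem coboundary_cochainPullback (n : ℕ) {X Y : Type*} [TopologicalSpace X] [TopologicalSpace Y]
    (f : C(X, Y)) (c : SingularCochain R n Y) :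
    coboundary R n X (cochainPullback R n f c) =
      cochainPullback R (n + 1) f (coboundary R n Y c) := rfl

/-- Pull-back of one-cocycles. -/
def cocyclePullback {X Y : Type*} [TopologicalSpace X] [TopologicalSpace Y] (f : C(X, Y)) :
    oneCocycles R Y →ₗ[R] oneCocycles R X :=
  (cochainPullback R 1 f).restrict fun c hc => by
    rw [oneCocycles, LinearMap.mem_ker] at hc ⊢
    rw [coboundary_cochainPullback, hc, map_zero]

/-- The map `f^* : H¹(Y; R) → H¹(X; R)` induced by a continuous map `f : X → Y`. -/
def cohomologyMap {X Y : Type*} [TopologicalSpace X] [TopologicalSpace Y] (f : C(X, Y)) :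
    CohomologyOne R Y →ₗ[R] CohomologyOne R X :=
  (oneCoboundaries R Y).mapQ (oneCoboundaries R X) (cocyclePullback R f) <| by
    rintro c ⟨b, hb⟩
    exact ⟨cochainPullback R 0 f b, by rw [coboundary_cochainPullback, hb]; rfl⟩

end Coefficients

/-- A group of homeomorphisms of `X` acts trivially on `H¹(X; ℝ)`. -/
def ActsTriviallyOnCohomology {X : Type*} [TopologicalSpace X] (G : Subgroup (X ≃ₜ X)) : Prop :=
  ∀ g ∈ G, ∀ c : CohomologyOne ℝ X, cohomologyMap ℝ (g : C(X, X)) c = c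

/-! ### Closed curves -/

/-- A closed curve `ℓ : ℝ / ℤ → X`, traversed once, as a singular one-simplex:
`(1 - t, t) ↦ ℓ (t mod 1)`. -/
def curveSimplex {X : Type*} [TopologicalSpace X] (ℓ : C(UnitAddCircle, X)) :
    SingularSimplex 1 X where
  toFun v := ℓ ((v.1 1 : ℝ) : UnitAddCircle)
  continuous_toFun := by
    have h : Continuous fun v : stdSimplex ℝ (Fin 2) => (v.1 1 : ℝ) :=
      (continuous_apply 1).comp continuous_subtype_val
    exact ℓ.continuous.comp ((AddCircle.continuous_mk' (1 : ℝ)).comp h)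

theorem curveSimplex_face {X : Type*} [TopologicalSpace X] (ℓ : C(UnitAddCircle, X))
    (i : Fin 2) (v : stdSimplex ℝ (Fin 1)) : (curveSimplex ℓ).face i v = ℓ 0 := by
  have h1 : v 0 = 1 := stdSimplex.eq_one_of_unique v 0
  change ℓ (((stdSimplex.map i.succAbove v) 1 : ℝ) : UnitAddCircle) = ℓ 0
  congr 1
  rw [stdSimplex.map_coe]
  rw [FunOnFinite.linearMap_apply_apply]
  fin_cases i
  · simp [Finset.filter_true_of_mem]
  · simp

theorem curveSimplex_mem {X : Type*} [TopologicalSpace X] (ℓ : C(UnitAddCircle, X)) :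
    simplexBasis ℝ 1 X (curveSimplex ℓ) ∈ oneCycles ℝ X := by
  have h : (curveSimplex ℓ).face 0 = (curveSimplex ℓ).face 1 := by
    ext v
    rw [curveSimplex_face, curveSimplex_face]
  rw [oneCycles, LinearMap.mem_ker, boundary, Module.Basis.constr_basis, Fin.sum_univ_two, h]
  simp

/-- The homology class `[ℓ]` in `H₁(X; ℝ)` of a closed curve. -/
def curveClass {X : Type*} [TopologicalSpace X] (ℓ : C(UnitAddCircle, X)) : HomologyOne ℝ X :=
  homologyClass ℝ X ⟨simplexBasis ℝ 1 X (curveSimplex ℓ), curveSimplex_mem ℓ⟩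

/-! ### Topological rotation number -/

/-- `F : ℝ → ℝ`, monotone, continuous and commuting with `t ↦ t + 1`, is a lift of the
homeomorphism `φ` of the circle `ℝ / ℤ`. -/
def IsLift (φ : UnitAddCircle ≃ₜ UnitAddCircle) (F : CircleDeg1Lift) : Prop :=
  Continuous F ∧ ∀ t : ℝ, ((F t : ℝ) : UnitAddCircle) = φ (t : UnitAddCircle)

/-- `φ` is an orientation preserving homeomorphism of the circle `ℝ / ℤ` and `ρ ∈ ℝ / ℤ` is its
topological rotation number: the class modulo `ℤ` of the translation number
`lim (F ^ n t - t) / n` of a lift `F` of `φ`. -/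
def HasRotationNumber (φ : UnitAddCircle ≃ₜ UnitAddCircle) (ρ : UnitAddCircle) : Prop :=
  ∃ F : CircleDeg1Lift, IsLift φ F ∧ ((F.translationNumber : ℝ) : UnitAddCircle) = ρ

/-- The homeomorphism `g` of `X` preserves the oriented simple closed curve `ℓ` (it maps the curve
onto itself, preserving its orientation), and `ρ` is the topological rotation number of the action
of `g` on the curve. -/
def PreservesWithRotationNumber {X : Type*} [TopologicalSpace X] (g : X ≃ₜ X)
    (ℓ : C(UnitAddCircle, X)) (ρ : UnitAddCircle) : Prop :=
  ∃ φ : UnitAddCircle ≃ₜ UnitAddCircle, (∀ t, g (ℓ t) = ℓ (φ t)) ∧ HasRotationNumber φ ρ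

/-- An element of `ℝ / ℤ` is rational if it lies in `ℚ / ℤ`. -/
def IsRational (ρ : UnitAddCircle) : Prop :=
  ∃ q : ℚ, ρ = ((q : ℝ) : UnitAddCircle)

end Distortion

end

noncomputable section

namespace Distortion

/-! ### Cocycles evaluated on paths -/

section Paths

variable {X : Type*} [TopologicalSpace X]

/-! Join the base points of the two curves by a path `γ`, and let `τ₁`, `τ₂` be the translation
numbers of lifts `F₁`, `F₂`. For a real one-cocycle `c`, the quantity c(gⁿγ) - c(γ) is computed in
two ways.

Since `g` fixes the class of `c`, g^*c - c is the coboundary of a function `b`. Telescoping over the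
iterates (`pathValue_pow_sub`) gives c(gⁿγ) - c(γ) = n·d + (c along `ℓ₂` from 0 to F₂ⁿ0) - (c along
`ℓ₁` from 0 to F₁ⁿ0), where `d` is the value of `c` on a fixed cycle with coefficients ±1. After
division by n the curve terms tend to τ₂c(ℓ₂) and τ₁c(ℓ₁).

On the other hand, `c` can be modified by a coboundary so that `b` is bounded for every element of
`G`. Then c(gⁿγ) - c(γ) is at most a constant times the word norm of gⁿ, which is o(n) for a
suitable generating set because `g` is distorted. Hence τ₁c(ℓ₁) - τ₂c(ℓ₂) = d for every `c`
(`translationNumber_relation`), so τ₁ℓ₁ - τ₂ℓ₂ is homologous to an integral cycle.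

Arithmetic follows by applying to the coefficients a ℚ-linear map θ : ℝ → ℚ with θ(1) = 0. It
commutes with the boundary and kills the integral cycle, leaving θ(τ₁)[ℓ₁] = θ(τ₂)[ℓ₂]. If the
classes are independent, every such θ kills both `τᵢ`, which are therefore rational. Otherwise [ℓ₁]
= q[ℓ₂], where q is rational by the same device, and θ(qτ₁ - τ₂) = 0 for all θ makes qτ₁ - τ₂
rational. -/

theorem sum_stdSimplex_map_smul {m n : ℕ} {V : Type*} [AddCommGroup V] [Module ℝ V]
    (f : Fin m → Fin n) (v : stdSimplex ℝ (Fin m)) (a : Fin n → V) :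
    ∑ j, (stdSimplex.map f v : stdSimplex ℝ (Fin n)) j • a j = ∑ i, v i • a (f i) := by
  have h : ∀ j, (stdSimplex.map f v : stdSimplex ℝ (Fin n)) j
      = ∑ i with f i = j, v i := fun j => by
    rw [stdSimplex.map_coe, FunOnFinite.linearMap_apply_apply]
  simp_rw [h, Finset.sum_smul]
  rw [← Finset.sum_fiberwise Finset.univ f]
  refine Finset.sum_congr rfl fun j _ => Finset.sum_congr rfl fun i hi => ?_
  rw [(Finset.mem_filter.1 hi).2]

/-- The composition of `q` with the affine simplex with vertices `a`. -/
def affineSimplex {V : Type*} [TopologicalSpace V] [AddCommGroup V] [Module ℝ V]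
    [ContinuousAdd V] [ContinuousSMul ℝ V] {n : ℕ} (q : C(V, X)) (a : Fin (n + 1) → V) :
    SingularSimplex n X where
  toFun v := q (∑ j, v j • a j)
  continuous_toFun := by
    refine q.continuous.comp (continuous_finsetSum _ fun j _ => ?_)
    exact ((continuous_apply j).comp continuous_subtype_val).smul continuous_const

theorem affineSimplex_face {V : Type*} [TopologicalSpace V] [AddCommGroup V] [Module ℝ V]
    [ContinuousAdd V] [ContinuousSMul ℝ V] {n : ℕ} (q : C(V, X)) (a : Fin (n + 2) → V)
    (i : Fin (n + 2)) : (affineSimplex q a).face i = affineSimplex q (a ∘ i.succAbove) := by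
  ext v
  exact congrArg q (sum_stdSimplex_map_smul _ v a)

/-- This is the cocycle condition on the affine triangle `x, y, z`, which may be degenerate. It
gives both additivity under concatenation (three points on a line) and homotopy invariance (a square
cut into triangles). -/
theorem cocycle_affineSimplex {V : Type*} [TopologicalSpace V] [AddCommGroup V] [Module ℝ V]
    [ContinuousAdd V] [ContinuousSMul ℝ V] (c : oneCocycles ℝ X) (q : C(V, X)) (x y z : V) :
    c.1 (affineSimplex q ![x, z]) =
      c.1 (affineSimplex q ![x, y]) + c.1 (affineSimplex q ![y, z]) := by
  have h : ∑ i : Fin 3, (-1 : ℝ) ^ (i : ℕ) * c.1 ((affineSimplex q ![x, y, z]).face i) = 0 :=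
    congrFun (LinearMap.mem_ker.1 c.2) (affineSimplex q ![x, y, z])
  have e0 : ![x, y, z] ∘ (0 : Fin 3).succAbove = ![y, z] := by
    ext i; fin_cases i <;> rfl
  have e1 : ![x, y, z] ∘ (1 : Fin 3).succAbove = ![x, z] := by
    ext i; fin_cases i <;> rfl
  have e2 : ![x, y, z] ∘ (2 : Fin 3).succAbove = ![x, y] := by
    ext i; fin_cases i <;> rfl
  rw [Fin.sum_univ_three, affineSimplex_face, affineSimplex_face, affineSimplex_face,
    e0, e1, e2] at h
  norm_num at h
  linarith

/-- A path as a singular one-simplex. -/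
def pathSimplex {x y : X} (γ : Path x y) : SingularSimplex 1 X where
  toFun v := γ.extend (v 1)
  continuous_toFun :=
    γ.continuous_extend.comp ((continuous_apply 1).comp continuous_subtype_val)

theorem stdSimplex_fin_two_zero (v : stdSimplex ℝ (Fin 2)) : v 0 = 1 - v 1 := by
  have := v.2.2
  rw [Fin.sum_univ_two] at this
  exact eq_sub_of_add_eq this

theorem affineSimplex_eq_pathSimplex {V : Type*} [TopologicalSpace V] [AddCommGroup V]
    [Module ℝ V] [ContinuousAdd V] [ContinuousSMul ℝ V] {x y : X} (q : C(V, X)) (a b : V)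
    (γ : Path x y) (h : ∀ t : unitInterval, q ((1 - t : ℝ) • a + (t : ℝ) • b) = γ t) :
    affineSimplex q ![a, b] = pathSimplex γ := by
  ext v
  have hv : v 1 ∈ unitInterval := ⟨v.2.1 1, by
    have := v.2.1 0
    have h2 := stdSimplex_fin_two_zero v
    change 0 ≤ v 0 at this
    linarith⟩
  change q (∑ j, v j • ![a, b] j) = γ.extend (v 1)
  rw [Path.extend_apply _ hv, ← h ⟨v 1, hv⟩, Fin.sum_univ_two, stdSimplex_fin_two_zero]
  rfl

/-- The value of a one-cochain on a path. -/
def pathValue (c : SingularCochain ℝ 1 X) {x y : X} (γ : Path x y) : ℝ := c (pathSimplex γ)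

theorem pathValue_trans (c : oneCocycles ℝ X) {x y z : X} (γ : Path x y) (γ' : Path y z) :
    pathValue c.1 (γ.trans γ') = pathValue c.1 γ + pathValue c.1 γ' := by
  have h := cocycle_affineSimplex c ⟨(γ.trans γ').extend, Path.continuous_extend _⟩
    (0 : ℝ) (1 / 2) 1
  rw [affineSimplex_eq_pathSimplex _ _ _ (γ.trans γ'), affineSimplex_eq_pathSimplex _ _ _ γ,
    affineSimplex_eq_pathSimplex _ _ _ γ'] at h
  · exact h
  · intro t
    obtain ⟨h0, h1⟩ := t.2
    change (γ.trans γ').extend _ = _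
    have ht : (1 - t : ℝ) • (1 / 2 : ℝ) + (t : ℝ) • (1 : ℝ) ∈ unitInterval := by
      simp only [smul_eq_mul]
      constructor <;> linarith
    rw [Path.extend_apply _ ht, Path.trans_apply]
    simp only [smul_eq_mul]
    split_ifs with h
    · have h3 : (t : ℝ) = 0 := by linarith
      have h4 : t = 0 := Subtype.ext h3
      subst h4
      rw [γ'.source]
      convert γ.target using 2
      ext
      simp
    · congr 1
      ext
      simp
      ring
  · intro t
    obtain ⟨h0, h1⟩ := t.2
    change (γ.trans γ').extend _ = _
    have ht : (1 - t : ℝ) • (0 : ℝ) + (t : ℝ) • (1 / 2 : ℝ) ∈ unitInterval := by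
      simp only [smul_eq_mul]
      constructor <;> linarith
    rw [Path.extend_apply _ ht, Path.trans_apply]
    simp only [smul_eq_mul]
    rw [dif_pos (by linarith)]
    congr 1
    ext
    simp
    ring
  · intro t
    change (γ.trans γ').extend _ = _
    simp

theorem pathValue_refl (c : oneCocycles ℝ X) (x : X) : pathValue c.1 (Path.refl x) = 0 := by
  have := pathValue_trans c (Path.refl x) (Path.refl x)
  rw [Path.refl_trans_refl] at this
  linarith

theorem pathValue_homotopic (c : oneCocycles ℝ X) {x y : X} {γ γ' : Path x y}
    (h : γ.Homotopic γ') : pathValue c.1 γ = pathValue c.1 γ' := by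
  obtain ⟨H⟩ := h
  let q : C(ℝ × ℝ, X) := ⟨fun v => H (Set.projIcc 0 1 zero_le_one v.1,
    Set.projIcc 0 1 zero_le_one v.2), by fun_prop⟩
  -- The two triangles of the square share the diagonal; the sides on which the homotopy is constant
  -- contribute 0.
  have h1 := cocycle_affineSimplex c q (0, 0) (0, 1) (1, 1)
  have h2 := cocycle_affineSimplex c q (0, 0) (1, 0) (1, 1)
  rw [affineSimplex_eq_pathSimplex q (0, 0) (0, 1) γ,
    affineSimplex_eq_pathSimplex q (0, 1) (1, 1) (Path.refl y)] at h1
  rw [affineSimplex_eq_pathSimplex q (0, 0) (1, 0) (Path.refl x),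
    affineSimplex_eq_pathSimplex q (1, 0) (1, 1) γ'] at h2
  · have h3 := pathValue_refl c x
    have h4 := pathValue_refl c y
    unfold pathValue at *
    linarith
  all_goals
    intro t
    simp [q]

theorem pathValue_eq_of_simplyConnected {E : Type*} [TopologicalSpace E] [SimplyConnectedSpace E]
    (q : C(E, X)) (c : oneCocycles ℝ X) {x y : E} (γ γ' : Path x y) :
    pathValue c.1 (γ.map q.continuous) = pathValue c.1 (γ'.map q.continuous) :=
  pathValue_homotopic c ((SimplyConnectedSpace.paths_homotopic γ γ').map q)

/-- The value of a one-cochain on the image of a path between two points of `E`. -/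
def transport {E : Type*} [TopologicalSpace E] [PathConnectedSpace E]
    (q : C(E, X)) (c : SingularCochain ℝ 1 X) (x y : E) : ℝ :=
  pathValue c ((PathConnectedSpace.somePath x y).map q.continuous)

theorem pathValue_map {E : Type*} [TopologicalSpace E] [SimplyConnectedSpace E]
    (q : C(E, X)) (c : oneCocycles ℝ X) {x y : E} (γ : Path x y) :
    pathValue c.1 (γ.map q.continuous) = transport q c.1 x y :=
  pathValue_eq_of_simplyConnected q c _ _

theorem transport_add {E : Type*} [TopologicalSpace E] [SimplyConnectedSpace E]
    (q : C(E, X)) (c : oneCocycles ℝ X) (x y z : E) :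
    transport q c.1 x y + transport q c.1 y z = transport q c.1 x z := by
  rw [← pathValue_map q c ((PathConnectedSpace.somePath x y).trans
    (PathConnectedSpace.somePath y z)), Path.map_trans, pathValue_trans]
  rfl

/-- A function whose increments along the paths in `U` are the values of the cochain. -/
def IsPrimitiveOn (c : SingularCochain ℝ 1 X) (f : X → ℝ) (U : Set X) : Prop :=
  ∀ ⦃x y : X⦄ (γ : Path x y), (∀ t, γ t ∈ U) → pathValue c γ = f y - f x

theorem IsPrimitiveOn.mono {c : SingularCochain ℝ 1 X} {f : X → ℝ} {U V : Set X}
    (h : IsPrimitiveOn c f U) (hVU : V ⊆ U) : IsPrimitiveOn c f V :=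
  fun _ _ γ hγ => h γ fun t => hVU (hγ t)

end Paths

/-! ### Local primitives, and cocycles whose primitives are bounded -/

section Primitives

variable {X : Type*} [TopologicalSpace X]

theorem pathSimplex_congr {x y x' y' : X} {γ : Path x y} {γ' : Path x' y'}
    (h : ∀ t, γ t = γ' t) : pathSimplex γ = pathSimplex γ' := by
  ext v
  exact h _

theorem pathValue_congr (c : SingularCochain ℝ 1 X) {x y x' y' : X} {γ : Path x y}
    {γ' : Path x' y'} (h : ∀ t, γ t = γ' t) : pathValue c γ = pathValue c γ' :=
  congrArg c (pathSimplex_congr h)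

theorem pathSimplex_eq_affineSimplex {x y : X} (γ : Path x y) :
    pathSimplex γ = affineSimplex ⟨γ.extend, γ.continuous_extend⟩ ![(0 : ℝ), 1] :=
  (affineSimplex_eq_pathSimplex _ _ _ γ fun t => by simp).symm

theorem affineSimplex_zero {V : Type*} [TopologicalSpace V] [AddCommGroup V] [Module ℝ V]
    [ContinuousAdd V] [ContinuousSMul ℝ V] (q : C(V, X)) (a : Fin 1 → V) :
    affineSimplex q a = ContinuousMap.const _ (q (a 0)) := by
  ext v
  have h : v 0 = 1 := stdSimplex.eq_one_of_unique (X := Fin 1) v 0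
  change q (∑ j, v j • a j) = q (a 0)
  rw [Fin.sum_univ_one, h, one_smul]

theorem pathSimplex_face_zero {x y : X} (γ : Path x y) :
    (pathSimplex γ).face 0 = ContinuousMap.const _ y := by
  rw [pathSimplex_eq_affineSimplex, affineSimplex_face, affineSimplex_zero]
  congr 1
  change γ.extend 1 = y
  simp

theorem pathSimplex_face_one {x y : X} (γ : Path x y) :
    (pathSimplex γ).face 1 = ContinuousMap.const _ x := by
  rw [pathSimplex_eq_affineSimplex, affineSimplex_face, affineSimplex_zero]
  congr 1
  change γ.extend 0 = x
  simp

theorem pathValue_coboundary (b : SingularCochain ℝ 0 X) {x y : X} (γ : Path x y) :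
    pathValue (coboundary ℝ 0 X b) γ =
      b (ContinuousMap.const _ y) - b (ContinuousMap.const _ x) := by
  change ∑ i : Fin 2, (-1 : ℝ) ^ (i : ℕ) * b ((pathSimplex γ).face i) = _
  rw [Fin.sum_univ_two, pathSimplex_face_zero, pathSimplex_face_one]
  norm_num
  ring

theorem ActsTriviallyOnCohomology.exists_primitive {G : Subgroup (X ≃ₜ X)}
    (hG : ActsTriviallyOnCohomology G) {g : X ≃ₜ X} (hg : g ∈ G) (c : oneCocycles ℝ X) :
    ∃ b : X → ℝ, ∀ ⦃x y : X⦄ (γ : Path x y),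
      pathValue c.1 (γ.map g.continuous) - pathValue c.1 γ = b y - b x := by
  have h := hG g hg (Submodule.Quotient.mk c)
  have h2 : cocyclePullback ℝ (g : C(X, X)) c - c ∈ oneCoboundaries ℝ X :=
    (Submodule.Quotient.eq _).1 h
  obtain ⟨b, hb⟩ := h2
  refine ⟨fun x => b (ContinuousMap.const _ x), fun x y γ => ?_⟩
  rw [← pathValue_coboundary b γ, hb]
  rfl

/-- The function `a` is arbitrary, with no continuity, since singular cochains are arbitrary
functions. This freedom is what allows unbounded primitives to be corrected. -/
theorem exists_cohomologous (c : oneCocycles ℝ X) (a : X → ℝ) :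
    ∃ c' : oneCocycles ℝ X, ∀ ⦃x y : X⦄ (γ : Path x y),
      pathValue c'.1 γ = pathValue c.1 γ + (a y - a x) := by
  let b : SingularCochain ℝ 0 X := fun σ => a (σ (stdSimplex.vertex 0))
  have hb : coboundary ℝ 0 X b ∈ oneCocycles ℝ X := by
    refine LinearMap.mem_ker.2 (funext fun σ => ?_)
    change ∑ i : Fin 3, (-1 : ℝ) ^ (i : ℕ) * ∑ j : Fin 2, (-1 : ℝ) ^ (j : ℕ) *
      a (σ (stdSimplex.map i.succAbove (stdSimplex.map j.succAbove (stdSimplex.vertex 0)))) = 0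
    simp only [stdSimplex.map_vertex, Fin.sum_univ_three, Fin.sum_univ_two]
    have e : (0 : Fin 3).succAbove ((0 : Fin 2).succAbove 0) = 2 ∧
        (0 : Fin 3).succAbove ((1 : Fin 2).succAbove 0) = 1 ∧
        (1 : Fin 3).succAbove ((0 : Fin 2).succAbove 0) = 2 ∧
        (1 : Fin 3).succAbove ((1 : Fin 2).succAbove 0) = 0 ∧
        (2 : Fin 3).succAbove ((0 : Fin 2).succAbove 0) = 1 ∧
        (2 : Fin 3).succAbove ((1 : Fin 2).succAbove 0) = 0 := by decide
    simp only [e]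
    norm_num
    ring
  refine ⟨c + ⟨_, hb⟩, fun x y γ => ?_⟩
  change pathValue c.1 γ + pathValue (coboundary ℝ 0 X b) γ = _
  rw [pathValue_coboundary]
  rfl

theorem surjective_of_isCoveringMap {E : Type*} [TopologicalSpace E] [Nonempty E]
    [ConnectedSpace X] {p : E → X} (hp : IsCoveringMap p) : Function.Surjective p := by
  rw [← Set.range_eq_univ]
  -- A fibre may a priori be empty, but then it is empty over a whole evenly covered neighbourhood,
  -- so the range is closed.
  refine IsClopen.eq_univ ⟨⟨isOpen_iff_mem_nhds.2 fun x hx => ?_⟩, hp.isOpenMap.isOpen_range⟩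
    (Set.range_nonempty p)
  obtain ⟨_, U, hxU, hU, _, H, hH⟩ := hp x
  refine mem_of_superset (hU.mem_nhds hxU) ?_
  rintro _ hy ⟨e, rfl⟩
  exact hx ⟨_, (H ⟨e, hy⟩).2.2⟩

/-- A space with a simply connected covering has local primitives of cocycles. -/
theorem exists_isPrimitiveOn {E : Type*} [TopologicalSpace E] [SimplyConnectedSpace E]
    [ConnectedSpace X] {p : E → X} (hp : IsCoveringMap p) (c : oneCocycles ℝ X) (x : X) :
    ∃ U ∈ 𝓝 x, ∃ f : X → ℝ, IsPrimitiveOn c.1 f U := by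
  obtain ⟨e, rfl⟩ := surjective_of_isCoveringMap hp x
  obtain ⟨φ, he, rfl⟩ := hp.isLocalHomeomorph e
  let q : C(E, X) := ⟨φ, hp.continuous⟩
  -- Paths in `φ.target` lift through `φ.symm` to the simply connected space `E`, where the value of
  -- the cocycle depends only on the endpoints.
  refine ⟨φ.target, φ.open_target.mem_nhds (φ.map_source he),
    fun y => transport q c.1 e (φ.symm y), fun y z γ hγ => ?_⟩
  have hc : ContinuousOn φ.symm (Set.range γ) :=
    φ.continuousOn_symm.mono (Set.range_subset_iff.2 hγ)
  have h : pathValue c.1 γ = pathValue c.1 ((γ.map' hc).map q.continuous) :=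
    pathValue_congr _ fun t => (φ.right_inv (hγ t)).symm
  rw [h, pathValue_map]
  exact eq_sub_of_add_eq' (transport_add q c e (φ.symm y) (φ.symm z))

/-- A cocycle admits near every point a bounded primitive. -/
def HasBoundedPrimitives (c : SingularCochain ℝ 1 X) : Prop :=
  ∀ x : X, ∃ V ∈ 𝓝 x, ∃ f : X → ℝ, IsPrimitiveOn c f V ∧ ∃ C, ∀ y ∈ V, |f y| ≤ C

theorem exists_isPathConnected_subset [LocallyPathConnectedSpace X] {x : X} {U : Set X}
    (hU : U ∈ 𝓝 x) : ∃ W ∈ 𝓝 x, W ⊆ U ∧ ∀ y ∈ W, ∃ γ : Path x y, ∀ t, γ t ∈ W := by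
  obtain ⟨W, ⟨hW, hc⟩, hWU⟩ := (path_connected_basis x).mem_iff.1 hU
  refine ⟨W, hW, hWU, fun y hy => ?_⟩
  obtain ⟨γ, hγ⟩ := hc.joinedIn x (mem_of_mem_nhds hW) y hy
  exact ⟨γ, hγ⟩

/-- Local primitives can be unbounded, but on a path-connected neighbourhood any two differ by a
constant. So one may take `-f` for a local primitive `f` on each of finitely many pieces covering
`X`, and glue with no compatibility condition: the sums stay locally bounded. -/
theorem exists_bounded_add_primitive [CompactSpace X] [T2Space X] [LocallyPathConnectedSpace X]
    {c : SingularCochain ℝ 1 X} (hc : ∀ x : X, ∃ U ∈ 𝓝 x, ∃ f : X → ℝ, IsPrimitiveOn c f U) :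
    ∃ a : X → ℝ, ∀ x : X, ∃ V ∈ 𝓝 x, ∃ f : X → ℝ, IsPrimitiveOn c f V ∧
      ∃ C, ∀ y ∈ V, |f y + a y| ≤ C := by
  let P : Set X → Prop := fun S => ∃ a : X → ℝ, ∀ x : X, ∃ V ∈ 𝓝 x, ∃ f : X → ℝ,
    IsPrimitiveOn c f V ∧ ∃ C, ∀ y ∈ V, y ∈ S → |f y + a y| ≤ C
  suffices h : P Set.univ by simpa [P] using h
  refine isCompact_univ.induction_on ?_ ?_ ?_ ?_
  · refine ⟨0, fun x => ?_⟩
    obtain ⟨U, hU, f, hf⟩ := hc x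
    exact ⟨U, hU, f, hf, 0, fun y _ h => h.elim⟩
  · rintro S T hST ⟨a, ha⟩
    refine ⟨a, fun x => ?_⟩
    obtain ⟨V, hV, f, hf, C, hC⟩ := ha x
    exact ⟨V, hV, f, hf, C, fun y hy h => hC y hy (hST h)⟩
  · rintro S T ⟨a, ha⟩ ⟨b, hb⟩
    classical
    refine ⟨fun x => if x ∈ S then a x else b x, fun x => ?_⟩
    obtain ⟨V, hV, f, hf, C, hC⟩ := ha x
    obtain ⟨V', hV', f', hf', C', hC'⟩ := hb x
    obtain ⟨W, hW, hWV, hWp⟩ := exists_isPathConnected_subset (inter_mem hV hV')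
    refine ⟨W, hW, f, hf.mono fun y hy => (hWV hy).1, max C (C' + |f x - f' x|),
      fun y hy hyST => ?_⟩
    by_cases hyS : y ∈ S
    · simp only [hyS, if_true]
      exact (hC y (hWV hy).1 hyS).trans (le_max_left _ _)
    · simp only [hyS, if_false]
      refine le_trans ?_ (le_max_right _ _)
      obtain ⟨γ, hγ⟩ := hWp y hy
      have h1 := hf γ fun t => (hWV (hγ t)).1
      have h2 := hf' γ fun t => (hWV (hγ t)).2
      have h3 : f y + b y = (f' y + b y) + (f x - f' x) := by linarith
      rw [h3]
      exact (abs_add_le _ _).trans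
        (add_le_add_left (hC' y (hWV hy).2 (hyST.resolve_left hyS)) _)
  · intro x _
    obtain ⟨U, hU, f, hf⟩ := hc x
    obtain ⟨S, hS, hSc, hSU⟩ := exists_mem_nhds_isClosed_subset (interior_mem_nhds.2 hU)
    -- At points of `S` the sum `f - f` vanishes; since `S` is closed, every other point has a
    -- neighbourhood missing it, where the bound is vacuous.
    refine ⟨S, mem_nhdsWithin_of_mem_nhds hS, -f, fun y => ?_⟩
    by_cases hy : y ∈ S
    · exact ⟨U, mem_interior_iff_mem_nhds.1 (hSU hy), f, hf, 0, fun z _ _ => by simp⟩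
    · obtain ⟨U', hU', f', hf'⟩ := hc y
      exact ⟨U' ∩ Sᶜ, inter_mem hU' (hSc.isOpen_compl.mem_nhds hy), f',
        hf'.mono Set.inter_subset_left, 0, fun z hz hzS => (hz.2 hzS).elim⟩

theorem exists_hasBoundedPrimitives [CompactSpace X] [T2Space X] [LocallyPathConnectedSpace X]
    (c : oneCocycles ℝ X)
    (hc : ∀ x : X, ∃ U ∈ 𝓝 x, ∃ f : X → ℝ, IsPrimitiveOn c.1 f U) :
    ∃ c' : oneCocycles ℝ X, HasBoundedPrimitives c'.1 ∧ ∃ a : X → ℝ, ∀ ⦃x y : X⦄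
      (γ : Path x y), pathValue c'.1 γ = pathValue c.1 γ + (a y - a x) := by
  obtain ⟨a, ha⟩ := exists_bounded_add_primitive hc
  obtain ⟨c', hc'⟩ := exists_cohomologous c a
  refine ⟨c', fun x => ?_, a, hc'⟩
  obtain ⟨V, hV, f, hf, C, hC⟩ := ha x
  refine ⟨V, hV, f + a, fun y z γ hγ => ?_, C, hC⟩
  rw [hc', hf γ hγ]
  simp only [Pi.add_apply]
  ring

theorem IsCompact.exists_abs_le {Y : Type*} [TopologicalSpace Y] {K : Set Y} (hK : IsCompact K)
    {b : Y → ℝ} (h : ∀ x, ∃ V ∈ 𝓝 x, ∃ C, ∀ y ∈ V, |b y - b x| ≤ C) :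
    ∃ C, ∀ x ∈ K, |b x| ≤ C := by
  refine hK.induction_on (p := fun S => ∃ C, ∀ x ∈ S, |b x| ≤ C) ⟨0, by simp⟩ ?_ ?_ ?_
  · rintro S T hST ⟨C, hC⟩
    exact ⟨C, fun x hx => hC x (hST hx)⟩
  · rintro S T ⟨C, hC⟩ ⟨D, hD⟩
    refine ⟨max C D, fun x hx => ?_⟩
    rcases hx with hx | hx
    exacts [(hC x hx).trans (le_max_left _ _), (hD x hx).trans (le_max_right _ _)]
  · intro x _
    obtain ⟨V, hV, C, hC⟩ := h x
    refine ⟨V, mem_nhdsWithin_of_mem_nhds hV, C + |b x|, fun y hy => ?_⟩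
    have := abs_add_le (b y - b x) (b x)
    rw [sub_add_cancel] at this
    linarith [hC y hy]

/-- The values of a cocycle with bounded primitives on short paths are bounded. -/
theorem HasBoundedPrimitives.exists_abs_pathValue_le {c : SingularCochain ℝ 1 X}
    (hc : HasBoundedPrimitives c) (x : X) :
    ∃ V ∈ 𝓝 x, ∃ C, ∀ ⦃y z : X⦄ (γ : Path y z), (∀ t, γ t ∈ V) → |pathValue c γ| ≤ C := by
  obtain ⟨V, hV, f, hf, C, hC⟩ := hc x
  refine ⟨V, hV, C + C, fun y z γ hγ => ?_⟩
  rw [hf γ hγ]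
  exact (abs_sub _ _).trans (add_le_add (hC z (γ.target ▸ hγ 1)) (hC y (γ.source ▸ hγ 0)))

/-- The increments of `b` along short paths are differences of values of `c` on short paths, hence
bounded; compactness then bounds `b` globally. The bound is uniform over all paths, long ones
included. -/
theorem ActsTriviallyOnCohomology.exists_bound [CompactSpace X] [LocallyPathConnectedSpace X]
    {G : Subgroup (X ≃ₜ X)}
    (hG : ActsTriviallyOnCohomology G) {g : X ≃ₜ X} (hg : g ∈ G) {c : oneCocycles ℝ X}
    (hc : HasBoundedPrimitives c.1) :
    ∃ C, ∀ ⦃x y : X⦄ (γ : Path x y),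
      |pathValue c.1 (γ.map g.continuous) - pathValue c.1 γ| ≤ C := by
  obtain ⟨b, hb⟩ := hG.exists_primitive hg c
  obtain ⟨C, hC⟩ := IsCompact.exists_abs_le (K := (Set.univ : Set X)) isCompact_univ (b := b)
    fun x => by
      obtain ⟨V, hV, C, hC⟩ := hc.exists_abs_pathValue_le x
      obtain ⟨V', hV', C', hC'⟩ := hc.exists_abs_pathValue_le (g x)
      obtain ⟨W, hW, hWV, hWp⟩ := exists_isPathConnected_subset
        (inter_mem hV (g.continuous.continuousAt.preimage_mem_nhds hV'))
      refine ⟨W, hW, C' + C, fun y hy => ?_⟩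
      obtain ⟨γ, hγ⟩ := hWp y hy
      rw [← hb γ]
      exact (abs_sub _ _).trans
        (add_le_add (hC' _ fun t => (hWV (hγ t)).2) (hC γ fun t => (hWV (hγ t)).1))
  refine ⟨C + C, fun x y γ => ?_⟩
  rw [hb γ]
  exact (abs_sub _ _).trans (add_le_add (hC y trivial) (hC x trivial))

end Primitives

/-! ### Sublinear growth for distorted elements -/

section DistortedElements

variable {X : Type*} [TopologicalSpace X]

theorem exists_abs_pathValue_pow_le [CompactSpace X] [LocallyPathConnectedSpace X]
    {G : Subgroup (X ≃ₜ X)} (hG : ActsTriviallyOnCohomology G) {c : oneCocycles ℝ X}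
    (hc : HasBoundedPrimitives c.1) {S : Set G} (hS : S.Finite) {g : G}
    (hg : g ∈ Subgroup.closure S) :
    ∃ C, ∀ (n : ℕ) ⦃x y : X⦄ (γ : Path x y),
      |pathValue c.1 (γ.map ((g : X ≃ₜ X) ^ n).continuous) - pathValue c.1 γ| ≤
        C * wordNorm S (g ^ n) := by
  choose K hK using fun h : G => hG.exists_bound h.2 hc
  -- Each letter of a word costs at most `C`, whatever path it is applied to, so the costs add along
  -- the word.
  obtain ⟨C, hC⟩ := ((hS.union hS.inv).image K).bddAbove
  have key : ∀ l : List G, (∀ s ∈ l, s ∈ S ∨ s⁻¹ ∈ S) → ∀ ⦃x y : X⦄ (γ : Path x y),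
      |pathValue c.1 (γ.map (l.prod : X ≃ₜ X).continuous) - pathValue c.1 γ| ≤
        C * l.length := by
    intro l
    induction l with
    | nil =>
      intro _ x y γ
      change |pathValue c.1 γ - pathValue c.1 γ| ≤ C * ((0 : ℕ) : ℝ)
      simp
    | cons s l ih =>
      intro hl x y γ
      have h1 := ih (fun s hs => hl s (List.mem_cons_of_mem _ hs)) γ
      have h2 := hK s (γ.map (l.prod : X ≃ₜ X).continuous)
      have h3 : K s ≤ C := hC ⟨s, hl s List.mem_cons_self, rfl⟩
      have h4 : pathValue c.1 (γ.map ((s :: l).prod : X ≃ₜ X).continuous) =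
          pathValue c.1 ((γ.map (l.prod : X ≃ₜ X).continuous).map (s : X ≃ₜ X).continuous) := by
        rw [List.prod_cons]
        rfl
      rw [h4, List.length_cons]
      push_cast
      rw [← sub_add_sub_cancel]
      refine (abs_add_le _ _).trans ?_
      linarith
  refine ⟨C, fun n x y γ => ?_⟩
  obtain ⟨l, hl, hp, hk⟩ := exists_word (pow_mem hg n)
  have := key l hl γ
  rw [hk, hp] at this
  exact this

theorem IsDistorted.tendsto_pathValue [CompactSpace X] [LocallyPathConnectedSpace X]
    {G : Subgroup (X ≃ₜ X)} (hG : ActsTriviallyOnCohomology G) {c : oneCocycles ℝ X}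
    (hc : HasBoundedPrimitives c.1) {g : G} (hg : IsDistorted g) {x y : X} (γ : Path x y) :
    Tendsto (fun n : ℕ => (pathValue c.1 (γ.map ((g : X ≃ₜ X) ^ n).continuous) -
      pathValue c.1 γ) / n) atTop (𝓝 0) := by
  unfold IsDistorted IsUndistorted at hg
  push Not at hg
  obtain ⟨S, hS, hgS, hτ⟩ := hg
  obtain ⟨C, hC⟩ := exists_abs_pathValue_pow_le hG hc hS hgS
  have ht := tendsto_translationLength hgS
  have h0 : 0 ≤ translationLength S g := ge_of_tendsto' ht fun n => by positivity
  rw [le_antisymm hτ h0] at ht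
  refine squeeze_zero_norm (fun n => ?_) (by simpa using ht.const_mul C)
  rw [Real.norm_eq_abs, abs_div, Nat.abs_cast, ← mul_div_assoc]
  gcongr
  exact hC n γ

end DistortedElements

/-! ### Invariant closed curves and translation numbers -/

section ClosedCurves

variable {X : Type*} [TopologicalSpace X]

/-- The periodic map `ℝ → X` given by a closed curve. -/
def curveLift (ℓ : C(UnitAddCircle, X)) : C(ℝ, X) :=
  ⟨fun t => ℓ (t : UnitAddCircle), ℓ.continuous.comp (AddCircle.continuous_mk' 1)⟩

theorem transport_curveLift_add_one (ℓ : C(UnitAddCircle, X)) (c : oneCocycles ℝ X) (s t : ℝ) :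
    transport (curveLift ℓ) c.1 (s + 1) (t + 1) = transport (curveLift ℓ) c.1 s t := by
  let γ : Path s t := PathConnectedSpace.somePath s t
  rw [← pathValue_map _ c γ, ← pathValue_map _ c (γ.map (f := (· + (1 : ℝ))) (by fun_prop))]
  refine pathValue_congr _ fun u => ?_
  change ℓ ((γ u + 1 : ℝ) : UnitAddCircle) = ℓ (γ u : UnitAddCircle)
  rw [AddCircle.coe_add, AddCircle.coe_period, add_zero]

theorem transport_zero_one (ℓ : C(UnitAddCircle, X)) (c : oneCocycles ℝ X) :
    transport (curveLift ℓ) c.1 0 1 = c.1 (curveSimplex ℓ) := by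
  let γ : Path (0 : ℝ) 1 := ⟨⟨fun t => t, by fun_prop⟩, rfl, rfl⟩
  rw [← pathValue_map _ c γ]
  refine congrArg c.1 ?_
  ext v
  have hv : v 1 ∈ unitInterval := ⟨v.2.1 1, by
    have := v.2.1 0
    have h2 := stdSimplex_fin_two_zero v
    change 0 ≤ v 0 at this
    linarith⟩
  change (γ.map (curveLift ℓ).continuous).extend (v 1) = ℓ ((v 1 : ℝ) : UnitAddCircle)
  rw [Path.extend_apply _ hv]
  rfl

theorem transport_self {E : Type*} [TopologicalSpace E] [SimplyConnectedSpace E]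
    (q : C(E, X)) (c : oneCocycles ℝ X) (x : E) : transport q c.1 x x = 0 := by
  have := transport_add q c x x x
  linarith

/-- Each full turn adds `c.1 (curveSimplex ℓ)`, so the difference is periodic. It need not be
continuous in `t`; its boundedness on a period comes from the bounded primitives. -/
theorem HasBoundedPrimitives.exists_abs_transport_sub_le {c : oneCocycles ℝ X}
    (hc : HasBoundedPrimitives c.1) (ℓ : C(UnitAddCircle, X)) :
    ∃ C, ∀ t : ℝ, |transport (curveLift ℓ) c.1 0 t - t * c.1 (curveSimplex ℓ)| ≤ C := by
  obtain ⟨C, hC⟩ := IsCompact.exists_abs_le (K := Set.Icc (0 : ℝ) 1) isCompact_Icc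
    (b := fun t => transport (curveLift ℓ) c.1 0 t) fun s => by
      obtain ⟨V, hV, C, hC⟩ := hc.exists_abs_pathValue_le (curveLift ℓ s)
      obtain ⟨W, hW, hWV, hWp⟩ := exists_isPathConnected_subset
        ((curveLift ℓ).continuous.continuousAt.preimage_mem_nhds hV)
      refine ⟨W, hW, C, fun t ht => ?_⟩
      obtain ⟨γ, hγ⟩ := hWp t ht
      have h := hC (γ.map (curveLift ℓ).continuous) fun u => hWV (hγ u)
      rw [pathValue_map] at h
      rwa [← transport_add _ c 0 s t, add_sub_cancel_left]
  set k := c.1 (curveSimplex ℓ) with hk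
  have hper : Function.Periodic (fun t => transport (curveLift ℓ) c.1 0 t - t * k) 1 := by
    intro t
    have h1 := transport_curveLift_add_one ℓ c 0 t
    have h2 := transport_add (curveLift ℓ) c 0 1 (t + 1)
    have h3 := transport_zero_one ℓ c
    rw [zero_add] at h1
    change _ - (t + 1) * k = _ - t * k
    linarith
  refine ⟨C + |k|, fun t => ?_⟩
  obtain ⟨s, hs, hst⟩ := hper.exists_mem_Ico₀ one_pos t
  change (transport (curveLift ℓ) c.1 0 t - t * k) = transport (curveLift ℓ) c.1 0 s - s * k at hst
  rw [hst]
  refine (abs_sub _ _).trans (add_le_add (hC s ⟨hs.1, hs.2.le⟩) ?_)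
  rw [abs_mul, abs_of_nonneg hs.1]
  exact mul_le_of_le_one_left (abs_nonneg k) hs.2.le

theorem HasBoundedPrimitives.tendsto_transport {c : oneCocycles ℝ X}
    (hc : HasBoundedPrimitives c.1) (ℓ : C(UnitAddCircle, X)) (F : CircleDeg1Lift) :
    Tendsto (fun n : ℕ => transport (curveLift ℓ) c.1 0 ((F ^ n) 0) / n) atTop
      (𝓝 (F.translationNumber * c.1 (curveSimplex ℓ))) := by
  obtain ⟨C, hC⟩ := hc.exists_abs_transport_sub_le ℓ
  have h1 := F.tendsto_translation_number₀.mul_const (c.1 (curveSimplex ℓ))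
  have h2 : Tendsto (fun n : ℕ => (transport (curveLift ℓ) c.1 0 ((F ^ n) 0) -
      (F ^ n) 0 * c.1 (curveSimplex ℓ)) / n) atTop (𝓝 0) := by
    refine squeeze_zero_norm (fun n => ?_) (tendsto_const_div_atTop_nhds_zero_nat C)
    rw [Real.norm_eq_abs, abs_div, Nat.abs_cast]
    gcongr
    exact hC _
  have h3 := h2.add h1
  rw [zero_add] at h3
  refine h3.congr fun n => ?_
  ring

theorem transport_curveLift_map {g : X ≃ₜ X} {ℓ : C(UnitAddCircle, X)} {F : CircleDeg1Lift}
    (hF : Continuous F) (hgF : ∀ t, g (curveLift ℓ t) = curveLift ℓ (F t)) (c : oneCocycles ℝ X)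
    {s t : ℝ} (γ : Path s t) :
    pathValue c.1 ((γ.map (curveLift ℓ).continuous).map g.continuous) =
      transport (curveLift ℓ) c.1 (F s) (F t) := by
  rw [← pathValue_map _ c (γ.map hF)]
  exact pathValue_congr _ fun u => hgF (γ u)

theorem pow_curveLift {g : X ≃ₜ X} {ℓ : C(UnitAddCircle, X)} {F : CircleDeg1Lift}
    (hgF : ∀ t, g (curveLift ℓ t) = curveLift ℓ (F t)) (n : ℕ) (t : ℝ) :
    (g ^ n) (curveLift ℓ t) = curveLift ℓ ((F ^ n) t) := by
  induction n with
  | zero => rfl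
  | succ n ih =>
    rw [pow_succ', pow_succ', CircleDeg1Lift.mul_apply, ← hgF, ← ih]
    rfl

/-- The factor of `n` is the value of `c` on the cycle formed by gγ, γ reversed, and the arcs of the
two curves from their base points to the images of these under `g`. Passing from gⁿγ to gⁿ⁺¹γ adds
the difference of `b` at the endpoints, which stay on the curves, where `key` expresses `b` through
`transport`. -/
theorem pathValue_pow_sub {G : Subgroup (X ≃ₜ X)} (hG : ActsTriviallyOnCohomology G)
    {g : X ≃ₜ X} (hg : g ∈ G) (c : oneCocycles ℝ X) {ℓ₁ ℓ₂ : C(UnitAddCircle, X)}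
    {F₁ F₂ : CircleDeg1Lift} (hF₁ : Continuous F₁) (hF₂ : Continuous F₂)
    (h₁ : ∀ t, g (curveLift ℓ₁ t) = curveLift ℓ₁ (F₁ t))
    (h₂ : ∀ t, g (curveLift ℓ₂ t) = curveLift ℓ₂ (F₂ t))
    (γ : Path (curveLift ℓ₁ 0) (curveLift ℓ₂ 0)) (n : ℕ) :
    pathValue c.1 (γ.map (g ^ n).continuous) - pathValue c.1 γ =
      n * (pathValue c.1 (γ.map g.continuous) - pathValue c.1 γ -
          transport (curveLift ℓ₂) c.1 0 (F₂ 0) + transport (curveLift ℓ₁) c.1 0 (F₁ 0)) +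
        (transport (curveLift ℓ₂) c.1 0 ((F₂ ^ n) 0) -
          transport (curveLift ℓ₁) c.1 0 ((F₁ ^ n) 0)) := by
  obtain ⟨b, hb⟩ := hG.exists_primitive hg c
  have key : ∀ {ℓ : C(UnitAddCircle, X)} {F : CircleDeg1Lift}, Continuous F →
      (∀ t, g (curveLift ℓ t) = curveLift ℓ (F t)) → ∀ t : ℝ,
      b (curveLift ℓ t) - b (curveLift ℓ 0) = transport (curveLift ℓ) c.1 0 (F t) -
        transport (curveLift ℓ) c.1 0 (F 0) - transport (curveLift ℓ) c.1 0 t := by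
    intro ℓ F hF h t
    let δ : Path 0 t := PathConnectedSpace.somePath 0 t
    rw [← hb (δ.map (curveLift ℓ).continuous), transport_curveLift_map hF h, pathValue_map,
      ← transport_add (curveLift ℓ) c 0 (F 0) (F t)]
    ring
  induction n with
  | zero =>
    have : pathValue c.1 (γ.map (g ^ 0).continuous) = pathValue c.1 γ := rfl
    simp [this, transport_self]
  | succ n ih =>
    have e : pathValue c.1 (γ.map (g ^ (n + 1)).continuous) =
        pathValue c.1 ((γ.map (g ^ n).continuous).map g.continuous) := by
      refine pathValue_congr _ fun t => ?_
      rw [pow_succ']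
      rfl
    have e1 := hb (γ.map (g ^ n).continuous)
    have e3 := congrArg b (pow_curveLift h₁ n 0)
    have e4 := congrArg b (pow_curveLift h₂ n 0)
    have k1 := key hF₁ h₁ ((F₁ ^ n) 0)
    have k2 := key hF₂ h₂ ((F₂ ^ n) 0)
    have e2 := hb γ
    rw [pow_succ' F₁, pow_succ' F₂, CircleDeg1Lift.mul_apply, CircleDeg1Lift.mul_apply]
    push_cast
    linarith

theorem transport_cohomologous {c c' : oneCocycles ℝ X} {a : X → ℝ}
    (h : ∀ ⦃x y : X⦄ (γ : Path x y), pathValue c'.1 γ = pathValue c.1 γ + (a y - a x))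
    {E : Type*} [TopologicalSpace E] [PathConnectedSpace E] (q : C(E, X)) (x y : E) :
    transport q c'.1 x y = transport q c.1 x y + (a (q y) - a (q x)) := h _

/-- The difference of the rotations of a distorted element along two invariant closed curves is the
value of any one-cocycle on a cycle with integral coefficients. -/
theorem translationNumber_relation {E : Type*} [TopologicalSpace E]
    [CompactSpace X] [T2Space X] [PathConnectedSpace X] [LocallyPathConnectedSpace X]
    [SimplyConnectedSpace E] {p : E → X} (hp : IsCoveringMap p)
    {G : Subgroup (X ≃ₜ X)} (hG : ActsTriviallyOnCohomology G) {g : G} (hg : IsDistorted g)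
    (c : oneCocycles ℝ X) {ℓ₁ ℓ₂ : C(UnitAddCircle, X)}
    {F₁ F₂ : CircleDeg1Lift} (hF₁ : Continuous F₁) (hF₂ : Continuous F₂)
    (h₁ : ∀ t, (g : X ≃ₜ X) (curveLift ℓ₁ t) = curveLift ℓ₁ (F₁ t))
    (h₂ : ∀ t, (g : X ≃ₜ X) (curveLift ℓ₂ t) = curveLift ℓ₂ (F₂ t))
    (γ : Path (curveLift ℓ₁ 0) (curveLift ℓ₂ 0)) :
    F₁.translationNumber * c.1 (curveSimplex ℓ₁) - F₂.translationNumber * c.1 (curveSimplex ℓ₂) =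
      pathValue c.1 (γ.map (g : X ≃ₜ X).continuous) - pathValue c.1 γ -
        transport (curveLift ℓ₂) c.1 0 (F₂ 0) + transport (curveLift ℓ₁) c.1 0 (F₁ 0) := by
  obtain ⟨c', hc', a, ha⟩ := exists_hasBoundedPrimitives c (exists_isPrimitiveOn hp c)
  have hcurve : ∀ ℓ : C(UnitAddCircle, X), c'.1 (curveSimplex ℓ) = c.1 (curveSimplex ℓ) := by
    intro ℓ
    rw [← transport_zero_one, ← transport_zero_one, transport_cohomologous ha]
    have : curveLift ℓ 1 = curveLift ℓ 0 := by
      change ℓ ((1 : ℝ) : UnitAddCircle) = ℓ ((0 : ℝ) : UnitAddCircle)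
      rw [AddCircle.coe_period, AddCircle.coe_zero]
    rw [this, sub_self, add_zero]
  -- The four paths form a cycle, so the endpoint contributions of `a` cancel.
  have hd : pathValue c'.1 (γ.map (g : X ≃ₜ X).continuous) - pathValue c'.1 γ -
      transport (curveLift ℓ₂) c'.1 0 (F₂ 0) + transport (curveLift ℓ₁) c'.1 0 (F₁ 0) =
      pathValue c.1 (γ.map (g : X ≃ₜ X).continuous) - pathValue c.1 γ -
        transport (curveLift ℓ₂) c.1 0 (F₂ 0) + transport (curveLift ℓ₁) c.1 0 (F₁ 0) := by
    rw [ha, ha γ, transport_cohomologous ha, transport_cohomologous ha]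
    linarith [congrArg a (h₁ 0), congrArg a (h₂ 0)]
  rw [← hd, ← hcurve, ← hcurve]
  set d := pathValue c'.1 (γ.map (g : X ≃ₜ X).continuous) - pathValue c'.1 γ -
      transport (curveLift ℓ₂) c'.1 0 (F₂ 0) + transport (curveLift ℓ₁) c'.1 0 (F₁ 0) with hd'
  have t0 := hg.tendsto_pathValue hG hc' γ
  have t1 := hc'.tendsto_transport ℓ₁ F₁
  have t2 := hc'.tendsto_transport ℓ₂ F₂
  have t3 := (tendsto_const_nhds (x := d)).add (t2.sub t1)
  have t4 := tendsto_nhds_unique_of_eventuallyEq t0 t3 ?_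
  · linarith
  · filter_upwards [eventually_gt_atTop 0] with n hn
    rw [pathValue_pow_sub hG g.2 c' hF₁ hF₂ h₁ h₂ γ n, ← hd']
    field_simp

end ClosedCurves

/-! ### Changing coefficients by rational functionals -/

section Coefficients

variable {X : Type*} [TopologicalSpace X]

/-- An additive map of the coefficients induces a map of chains. -/
def mapCoefficients (θ : ℝ →+ ℝ) (n : ℕ) (X : Type*) [TopologicalSpace X] :
    SingularChain ℝ n X →+ SingularChain ℝ n X :=
  Finsupp.mapRange.addMonoidHom (ι := SingularSimplex n X) θ

theorem smul_simplexBasis {n : ℕ} (r : ℝ) (σ : SingularSimplex n X) :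
    r • simplexBasis ℝ n X σ = (Finsupp.single σ r : SingularSimplex n X →₀ ℝ) :=
  (Finsupp.smul_single r σ (1 : ℝ)).trans (by rw [smul_eq_mul, mul_one])

theorem mapCoefficients_smul (θ : ℝ →+ ℝ) {n : ℕ} (r : ℝ) (σ : SingularSimplex n X) :
    mapCoefficients θ n X (r • simplexBasis ℝ n X σ) = θ r • simplexBasis ℝ n X σ := by
  rw [smul_simplexBasis, smul_simplexBasis]
  exact Finsupp.mapRange_single (f := θ) (hf := θ.map_zero)

/-- Additivity of `θ` suffices, as the boundary has coefficients ±1. -/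
theorem mapCoefficients_boundary (θ : ℝ →+ ℝ) {n : ℕ} (z : SingularChain ℝ (n + 1) X) :
    mapCoefficients θ n X (boundary ℝ n X z) = boundary ℝ n X (mapCoefficients θ (n + 1) X z) := by
  refine Finsupp.induction_linear (motive := fun z : SingularChain ℝ (n + 1) X =>
    mapCoefficients θ n X (boundary ℝ n X z) = boundary ℝ n X (mapCoefficients θ (n + 1) X z))
    z ?_ ?_ ?_
  · exact (congrArg _ (map_zero _)).trans ((map_zero _).trans
      ((congrArg _ (map_zero _)).trans (map_zero _)).symm)
  · intro z w hz hw
    exact (congrArg _ (map_add _ z w)).trans ((map_add _ _ _).trans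
      ((congrArg₂ (· + ·) hz hw).trans
        ((congrArg _ (map_add _ z w)).trans (map_add _ _ _)).symm))
  · intro σ r
    have hθ : ∀ k : ℕ, θ ((-1) ^ k * r) = (-1) ^ k * θ r := fun k => by
      rcases neg_one_pow_eq_or ℝ k with h | h <;> simp [h]
    have hb : ∀ s : ℝ, boundary ℝ n X (s • simplexBasis ℝ (n + 1) X σ) =
        ∑ i : Fin (n + 2), ((-1) ^ (i : ℕ) * s) • simplexBasis ℝ n X (σ.face i) := fun s => by
      rw [map_smul, boundary, Module.Basis.constr_basis, Finset.smul_sum]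
      exact Finset.sum_congr rfl fun i _ => by rw [smul_smul, mul_comm]
    rw [← smul_simplexBasis r σ, mapCoefficients_smul, hb, hb, map_sum]
    exact Finset.sum_congr rfl fun i _ => by rw [mapCoefficients_smul, hθ]

theorem mapCoefficients_mem_range (θ : ℝ →+ ℝ) {n : ℕ} {z : SingularChain ℝ n X}
    (hz : z ∈ LinearMap.range (boundary ℝ n X)) :
    mapCoefficients θ n X z ∈ LinearMap.range (boundary ℝ n X) := by
  obtain ⟨w, rfl⟩ := hz
  exact ⟨_, (mapCoefficients_boundary θ w).symm⟩

/-- Over a field, a vector outside a subspace is detected by a functional vanishing on the subspace;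
a functional vanishing on boundaries is a cocycle. -/
theorem mem_range_boundary_of_cocycles {z : SingularChain ℝ 1 X}
    (h : ∀ c : oneCocycles ℝ X, (simplexBasis ℝ 1 X).constr ℝ c.1 z = 0) :
    z ∈ LinearMap.range (boundary ℝ 1 X) := by
  by_contra hz
  obtain ⟨f, hfz, hf⟩ := Submodule.exists_le_ker_of_notMem hz
  refine hfz ?_
  have hc : (fun σ => f (simplexBasis ℝ 1 X σ)) ∈ oneCocycles ℝ X := by
    refine LinearMap.mem_ker.2 (funext fun σ => ?_)
    have h1 : f (boundary ℝ 1 X (simplexBasis ℝ 2 X σ)) = 0 := hf ⟨_, rfl⟩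
    rw [boundary, Module.Basis.constr_basis, map_sum] at h1
    simp only [map_smul, smul_eq_mul] at h1
    exact h1
  have h2 := h ⟨_, hc⟩
  rwa [Module.Basis.constr_self] at h2

theorem smul_curveClass_eq_iff {ℓ₁ ℓ₂ : C(UnitAddCircle, X)} (r₁ r₂ : ℝ) :
    r₁ • simplexBasis ℝ 1 X (curveSimplex ℓ₁) - r₂ • simplexBasis ℝ 1 X (curveSimplex ℓ₂) ∈
      LinearMap.range (boundary ℝ 1 X) ↔ r₁ • curveClass ℓ₁ = r₂ • curveClass ℓ₂ := by
  let z : C(UnitAddCircle, X) → oneCycles ℝ X := fun ℓ => ⟨_, curveSimplex_mem ℓ⟩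
  change r₁ • (z ℓ₁ : SingularChain ℝ 1 X) - r₂ • (z ℓ₂ : SingularChain ℝ 1 X) ∈ _ ↔
    r₁ • homologyClass ℝ X (z ℓ₁) = r₂ • homologyClass ℝ X (z ℓ₂)
  rw [← map_smul (homologyClass ℝ X), ← map_smul (homologyClass ℝ X)]
  exact (Submodule.Quotient.eq (oneBoundaries ℝ X) (x := r₁ • z ℓ₁) (y := r₂ • z ℓ₂)).symm

theorem exists_rat_eq {t : ℝ} (h : ∀ θ : ℝ →ₗ[ℚ] ℚ, θ 1 = 0 → θ t = 0) : ∃ q : ℚ, t = q := by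
  by_contra hq
  have ht : t ∉ Submodule.span ℚ {(1 : ℝ)} := by
    intro ht
    obtain ⟨q, rfl⟩ := Submodule.mem_span_singleton.1 ht
    exact hq ⟨q, by rw [Rat.smul_def, mul_one]⟩
  obtain ⟨θ, hθ, hle⟩ := Submodule.exists_le_ker_of_notMem ht
  exact hθ (h θ (hle (Submodule.mem_span_singleton_self 1)))

/-- A rational functional as an additive map of the real coefficients. -/
def realOfRatFunctional (θ : ℝ →ₗ[ℚ] ℚ) : ℝ →+ ℝ :=
  (Rat.castHom ℝ).toAddMonoidHom.comp θ.toAddMonoidHom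

theorem IsRational.exists_zsmul_eq_zero {ρ : UnitAddCircle} (h : IsRational ρ) :
    ∃ k : ℤ, k ≠ 0 ∧ k • ρ = 0 := by
  obtain ⟨q, rfl⟩ := h
  refine ⟨q.den, by exact_mod_cast q.den_ne_zero, ?_⟩
  rw [← AddCircle.coe_zsmul, AddCircle.coe_eq_zero_iff]
  refine ⟨q.num, ?_⟩
  have h : (q * q.den : ℚ) = q.num := Rat.mul_den_eq_num q
  have h' : (q * q.den : ℝ) = q.num := by exact_mod_cast h
  simp only [zsmul_eq_mul, mul_one, Int.cast_natCast]
  rw [← h', mul_comm]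

theorem exists_zsmul_eq_zsmul {t₁ t₂ : ℝ} {r s : ℚ} (hr : r ≠ 0) (h : r * t₁ - t₂ = s) :
    ∃ k₁ k₂ : ℤ, k₁ ≠ 0 ∧ k₂ ≠ 0 ∧ k₁ • (t₁ : UnitAddCircle) = k₂ • (t₂ : UnitAddCircle) := by
  -- These come from multiplying `r * t₁ - t₂ = s` by `r.den * s.den`; the right-hand side becomes
  -- the integer `r.den * s.num`.
  refine ⟨s.den * r.num, s.den * r.den, mul_ne_zero (by exact_mod_cast s.den_ne_zero)
    (Rat.num_ne_zero.2 hr), by exact_mod_cast mul_ne_zero s.den_ne_zero r.den_ne_zero, ?_⟩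
  rw [← AddCircle.coe_zsmul, ← AddCircle.coe_zsmul, ← sub_eq_zero, ← AddCircle.coe_sub,
    AddCircle.coe_eq_zero_iff]
  refine ⟨r.den * s.num, ?_⟩
  have h1 : (r * r.den : ℝ) = r.num := by exact_mod_cast Rat.mul_den_eq_num r
  have h2 : (s * s.den : ℝ) = s.num := by exact_mod_cast Rat.mul_den_eq_num s
  simp only [zsmul_eq_mul, mul_one, Int.cast_mul, Int.cast_natCast]
  rw [← h1, ← h2, ← h]
  ring

/-- The linear relations in the proof, for the coefficients transformed by a rational functional. -/
theorem rat_functional_relation {t₁ t₂ : ℝ} {ℓ₁ ℓ₂ : C(UnitAddCircle, X)}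
    {σ₁ σ₂ σ₃ σ₄ : SingularSimplex 1 X}
    (h : ∀ c : oneCocycles ℝ X, t₁ * c.1 (curveSimplex ℓ₁) - t₂ * c.1 (curveSimplex ℓ₂) =
      c.1 σ₁ - c.1 σ₂ - c.1 σ₃ + c.1 σ₄)
    {θ : ℝ →ₗ[ℚ] ℚ} (hθ : θ 1 = 0) :
    (θ t₁ : ℝ) • curveClass ℓ₁ = (θ t₂ : ℝ) • curveClass ℓ₂ := by
  rw [← smul_curveClass_eq_iff]
  let e := simplexBasis ℝ 1 X
  have hz : t₁ • e (curveSimplex ℓ₁) - t₂ • e (curveSimplex ℓ₂) - ((1 : ℝ) • e σ₁ -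
      (1 : ℝ) • e σ₂ - (1 : ℝ) • e σ₃ + (1 : ℝ) • e σ₄) ∈ LinearMap.range (boundary ℝ 1 X) := by
    refine mem_range_boundary_of_cocycles fun c => ?_
    simp only [map_sub, map_add, map_smul, e, Module.Basis.constr_basis, smul_eq_mul, one_mul]
    rw [h c, sub_self]
  have h2 := mapCoefficients_mem_range (realOfRatFunctional θ) hz
  have hθ' : realOfRatFunctional θ 1 = 0 := by
    change ((θ 1 : ℚ) : ℝ) = 0
    rw [hθ, Rat.cast_zero]
  simp only [map_sub, map_add, e, mapCoefficients_smul, hθ', zero_smul, sub_zero, add_zero] at h2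
  exact h2

/-- Both curves are integral cycles: a functional `θ` killing 1 turns the relation into 0 =
θ(r)[ℓ₂], which forces θ(r) = 0. -/
theorem exists_rat_of_curveClass_eq_smul {ℓ₁ ℓ₂ : C(UnitAddCircle, X)} {r : ℝ}
    (h₂ : curveClass ℓ₂ ≠ 0) (h : curveClass ℓ₁ = r • curveClass ℓ₂) : ∃ q : ℚ, r = q := by
  refine exists_rat_eq fun θ hθ => ?_
  rw [← one_smul ℝ (curveClass ℓ₁), ← smul_curveClass_eq_iff] at h
  have h' := mapCoefficients_mem_range (realOfRatFunctional θ) h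
  rw [map_sub, mapCoefficients_smul, mapCoefficients_smul, smul_curveClass_eq_iff] at h'
  change ((θ 1 : ℚ) : ℝ) • _ = ((θ r : ℚ) : ℝ) • _ at h'
  rw [hθ, Rat.cast_zero, zero_smul] at h'
  exact_mod_cast (smul_eq_zero.1 h'.symm).resolve_right h₂

end Coefficients

/-! ### Lifts and the conclusion -/

theorem PreservesWithRotationNumber.exists_lift {X : Type*} [TopologicalSpace X] {g : X ≃ₜ X}
    {ℓ : C(UnitAddCircle, X)} {ρ : UnitAddCircle} (h : PreservesWithRotationNumber g ℓ ρ) :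
    ∃ F : CircleDeg1Lift, Continuous F ∧ (∀ t, g (curveLift ℓ t) = curveLift ℓ (F t)) ∧
      ((F.translationNumber : ℝ) : UnitAddCircle) = ρ := by
  obtain ⟨φ, hφ, F, ⟨hF, hFφ⟩, hρ⟩ := h
  refine ⟨F, hF, fun t => ?_, hρ⟩
  change g (ℓ (t : UnitAddCircle)) = ℓ ((F t : ℝ) : UnitAddCircle)
  rw [hφ, hFφ]

end Distortion

end

open Distortion in
theorem mainTheorem11 {X E : Type*} [TopologicalSpace X] [TopologicalSpace E]
    [CompactSpace X] [T2Space X] [PathConnectedSpace X] [LocallyPathConnectedSpace X]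
    [SimplyConnectedSpace E] (p : E → X) (hp : IsCoveringMap p)
    (G : Subgroup (X ≃ₜ X)) (hG : ActsTriviallyOnCohomology G)
    (g : G) (hg : IsDistorted g)
    (ℓ₁ ℓ₂ : C(UnitAddCircle, X))
    (hℓ₁ : Function.Injective ℓ₁) (hℓ₂ : Function.Injective ℓ₂)
    (hc₁ : curveClass ℓ₁ ≠ 0) (hc₂ : curveClass ℓ₂ ≠ 0)
    (ρ₁ ρ₂ : UnitAddCircle)
    (hρ₁ : PreservesWithRotationNumber (g : X ≃ₜ X) ℓ₁ ρ₁)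
    (hρ₂ : PreservesWithRotationNumber (g : X ≃ₜ X) ℓ₂ ρ₂) :
    (∃ k₁ k₂ : ℤ, k₁ ≠ 0 ∧ k₂ ≠ 0 ∧ k₁ • ρ₁ = k₂ • ρ₂) ∧
    (LinearIndependent ℝ ![curveClass ℓ₁, curveClass ℓ₂] → IsRational ρ₁ ∧ IsRational ρ₂) := by
  obtain ⟨F₁, hF₁, h₁, rfl⟩ := hρ₁.exists_lift
  obtain ⟨F₂, hF₂, h₂, rfl⟩ := hρ₂.exists_lift
  let γ : Path (curveLift ℓ₁ 0) (curveLift ℓ₂ 0) := PathConnectedSpace.somePath _ _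
  have hrel : ∀ θ : ℝ →ₗ[ℚ] ℚ, θ 1 = 0 → (θ F₁.translationNumber : ℝ) • curveClass ℓ₁ =
      (θ F₂.translationNumber : ℝ) • curveClass ℓ₂ := fun θ hθ =>
    rat_functional_relation
      (fun c => translationNumber_relation hp hG hg c hF₁ hF₂ h₁ h₂ γ) hθ
  have hind : LinearIndependent ℝ ![curveClass ℓ₁, curveClass ℓ₂] →
      IsRational (F₁.translationNumber : UnitAddCircle) ∧
        IsRational (F₂.translationNumber : UnitAddCircle) := by
    intro hli
    rw [LinearIndependent.pair_iff] at hli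
    have h0 : ∀ θ : ℝ →ₗ[ℚ] ℚ, θ 1 = 0 →
        θ F₁.translationNumber = 0 ∧ θ F₂.translationNumber = 0 := fun θ hθ => by
      have := hli _ (-(θ F₂.translationNumber : ℝ))
        (by rw [hrel θ hθ, neg_smul, add_neg_cancel])
      exact ⟨by exact_mod_cast this.1, by exact_mod_cast neg_eq_zero.1 this.2⟩
    obtain ⟨q₁, e₁⟩ := exists_rat_eq fun θ hθ => (h0 θ hθ).1
    obtain ⟨q₂, e₂⟩ := exists_rat_eq fun θ hθ => (h0 θ hθ).2
    exact ⟨⟨q₁, by rw [e₁]⟩, ⟨q₂, by rw [e₂]⟩⟩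
  refine ⟨?_, hind⟩
  by_cases hli : LinearIndependent ℝ ![curveClass ℓ₁, curveClass ℓ₂]
  · obtain ⟨k₁, hk₁, e₁⟩ := (hind hli).1.exists_zsmul_eq_zero
    obtain ⟨k₂, hk₂, e₂⟩ := (hind hli).2.exists_zsmul_eq_zero
    exact ⟨k₁, k₂, hk₁, hk₂, e₁.trans e₂.symm⟩
  · rw [LinearIndependent.pair_symm_iff, LinearIndependent.pair_iff' hc₂] at hli
    push Not at hli
    obtain ⟨r, hr⟩ := hli
    obtain ⟨q, rfl⟩ := exists_rat_of_curveClass_eq_smul hc₂ hr.symm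
    have hq : q ≠ 0 := by
      rintro rfl
      rw [Rat.cast_zero, zero_smul] at hr
      exact hc₁ hr.symm
    obtain ⟨s, hs⟩ := exists_rat_eq (t := q * F₁.translationNumber - F₂.translationNumber)
      fun θ hθ => by
        have h := hrel θ hθ
        rw [← hr, smul_smul] at h
        have h' : θ F₁.translationNumber * q = θ F₂.translationNumber := by
          exact_mod_cast smul_left_injective ℝ hc₂ h
        -- The rationality of `q` is essential here: `θ` is only ℚ-linear.
        rw [map_sub, ← Rat.smul_def, map_smul, smul_eq_mul, ← h', mul_comm, sub_self]
    exact exists_zsmul_eq_zsmul hq hs
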